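/- A prop $T$ (coloured, in sets) consists of a set $\mathrm{Col}(T)$ of colours; for all finite, possibly empty, lists of colours a set of operations $T(a_1,\dots,a_n;b_1,\dots,b_m)$; identities $\mathrm{id}_c\in T(c;c)$; vertical compositions $\circ_v\colon T(\underline a;\underline b)\times T(\underline c;\underline a)\to T(\underline c;\underline b)$; horizontal compositions $\circ_h\colon T(\underline a;\underline b)\times T(\underline a';\underline b')\to T(\underline a\,\underline a';\underline b\,\underline b')$ (concatenation of lists), together with an empty horizontal composite $\mathrm{id}_\varnothing\in T(\ ;\ )$; and actions $\sigma^*\colon T(\langle a_i\rangle;\underline b)\to T(\langle a_{\sigma(i)}\rangle;\underline b)$ and $\tau_*\colon T(\underline a;\langle b_k\rangle)\to T(\underline a;\langle b_{\tau^{-1}(k)}\rangle)$ of permutations of the inputs and of the outputs. These satisfy: $\circ_v$ and $\circ_h$ are associative; $\mathrm{id}_\varnothing$ is a two-sided unit for $\circ_h$; $f\circ_v(\mathrm{id}_{a_1}\circ_h\cdots\circ_h\mathrm{id}_{a_n})=f=(\mathrm{id}_{b_1}\circ_h\cdots\circ_h\mathrm{id}_{b_m})\circ_v f$ (the empty composite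 being $\mathrm{id}_\varnothing$); $(f\circ_v g)\circ_h(f'\circ_v g')=(f\circ_h f')\circ_v(g\circ_h g')$ whenever the vertical composites on the left are defined; $f\circ_v(\sigma_*g)=(\sigma^*f)\circ_v g$, $\sigma^*(f\circ_v g)=f\circ_v\sigma^*g$, $\tau_*(f\circ_v g)=(\tau_*f)\circ_v g$; $(\sigma^*f)\circ_h(\bar\sigma^*g)=(\sigma\times\bar\sigma)^*(f\circ_h g)$, $(\tau_*f)\circ_h(\bar\tau_*g)=(\tau\times\bar\tau)_*(f\circ_h g)$; interchanging the two blocks of inputs and the two blocks of outputs (by the order-preserving block permutations) carries $f\circ_h g$ to $g\circ_h f$; $\sigma^*\tau_*=\tau_*\sigma^*$, $\sigma^*\bar\sigma^*=(\bar\sigma\sigma)^*$, $\tau_*\bar\tau_*=(\tau\bar\tau)_*$, and neutral permutations act trivially. A homomorphism of props is a map of colours together with maps of the sets of operations over it, compatible with the identities (including $\mathrm{id}_\varnothing$), both compositions and both actions. Let $\mathbf{Prop}$ be the category of props and homomorphisms. Theorem. The category $\mathbf{Prop}$ has all small colimits. It also has all small limits, and these are computed on colours and operations: a cone over a small diagram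 in $\mathbf{Prop}$ is a limit cone if and only if its image in $\mathbf{Set}$ under $T\mapsto\mathrm{Col}(T)$ is a limit cone and, for all $n,m\ge 0$, its image in $\mathbf{Set}$ under $T\mapsto\coprod_{a_1,\dots,a_n,b_1,\dots,b_m\in\mathrm{Col}(T)}T(a_1,\dots,a_n;b_1,\dots,b_m)$ is a limit cone. -/

import Mathlib

open CategoryTheory

universe u

/-- The raw data of a (coloured) prop. A list of colours `⟨a₁, …, aₙ⟩` is a function `Fin n → Col`.
Permutations act on the right on the inputs, `(σ^* f) : a ∘ σ → b`, and on the left on the outputs,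
`(τ_* f) : a → b ∘ τ⁻¹`. -/
structure PropData where
  /-- the set of colours -/
  Col : Type u
  /-- the set of operations `T(a₁, …, aₙ; b₁, …, bₘ)` -/
  Op : {n m : ℕ} → (Fin n → Col) → (Fin m → Col) → Type u
  /-- the identity `id_c ∈ T(c; c)` -/
  idCol : (c : Col) → Op (fun _ : Fin 1 => c) (fun _ : Fin 1 => c)
  /-- the empty horizontal composite of identities, in `T(⟨⟩; ⟨⟩)`
  (there is just one `a : Fin 0 → Col`) -/
  idNil : (a : Fin 0 → Col) → Op a a
  /-- vertical composition -/
  vcomp : {n m p : ℕ} → {c : Fin p → Col} → {a : Fin n → Col} → {b : Fin m → Col} →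
    Op a b → Op c a → Op c b
  /-- horizontal composition -/
  hcomp : {n m p q : ℕ} → {a : Fin n → Col} → {b : Fin m → Col} →
    {a' : Fin p → Col} → {b' : Fin q → Col} →
    Op a b → Op a' b' → Op (Fin.append a a') (Fin.append b b')
  /-- `σ^*` -/
  inAct : {n m : ℕ} → {a : Fin n → Col} → {b : Fin m → Col} → (σ : Equiv.Perm (Fin n)) →
    Op a b → Op (a ∘ σ) b
  /-- `τ_*` -/
  outAct : {n m : ℕ} → {a : Fin n → Col} → {b : Fin m → Col} → (τ : Equiv.Perm (Fin m)) →
    Op a b → Op a (b ∘ τ.symm)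

namespace PropData

/-- The type equality behind `PropData.transport`. -/
theorem op_congr (T : PropData.{u}) {n n' m m' : ℕ} {a : Fin n → T.Col} {a' : Fin n' → T.Col}
    {b : Fin m → T.Col} {b' : Fin m' → T.Col} (hn : n = n') (hm : m = m')
    (ha : a = a' ∘ Fin.cast hn) (hb : b = b' ∘ Fin.cast hm) : T.Op a b = T.Op a' b' := by
  subst hn hm ha hb
  rfl

/-- `T(a; b) = T(a'; b')` when `a`, `a'` are the same list and `b`, `b'` are the same list; this is
the (identity) function from the first set to the second. -/
def transport (T : PropData.{u}) {n n' m m' : ℕ} {a : Fin n → T.Col} {a' : Fin n' → T.Col}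
    {b : Fin m → T.Col} {b' : Fin m' → T.Col} (hn : n = n') (hm : m = m')
    (ha : a = a' ∘ Fin.cast hn) (hb : b = b' ∘ Fin.cast hm) (f : T.Op a b) : T.Op a' b' :=
  cast (T.op_congr hn hm ha hb) f

theorem append_init {C : Type u} {n : ℕ} (a : Fin (n + 1) → C) :
    Fin.append (Fin.init a) (fun _ : Fin 1 => a (Fin.last n)) = a ∘ Fin.cast rfl := by
  rw [Fin.append_right_eq_snoc]
  exact Fin.snoc_init_self a

/-- `id_{a₁} ∘ₕ ⋯ ∘ₕ id_{aₙ}` -/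
def idList (T : PropData.{u}) : {n : ℕ} → (a : Fin n → T.Col) → T.Op a a
  | 0, a => T.idNil a
  | n + 1, a => T.transport rfl rfl (append_init a) (append_init a)
      (T.hcomp (idList T (Fin.init a)) (T.idCol (a (Fin.last n))))

/-- `σ × σ'`, the image of a pair of permutations under `Σₙ × Σₚ ↪ Σₙ₊ₚ`. -/
def prodPerm {n p : ℕ} (σ : Equiv.Perm (Fin n)) (σ' : Equiv.Perm (Fin p)) :
    Equiv.Perm (Fin (n + p)) :=
  finSumFinEquiv.permCongr (Equiv.sumCongr σ σ')

/-- The permutation of `{1, …, x + y}` with increasing restrictions `[1, y] ≅ [x + 1, x + y]` and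
`[1 + y, x + y] ≅ [1, x]`. -/
def blockSwap (x y : ℕ) : Equiv.Perm (Fin (x + y)) :=
  (finCongr (Nat.add_comm x y)).trans finAddFlip

theorem append_comp_prodPerm {C : Type u} {n p : ℕ} (a : Fin n → C) (a' : Fin p → C)
    (σ : Equiv.Perm (Fin n)) (σ' : Equiv.Perm (Fin p)) :
    Fin.append (a ∘ σ) (a' ∘ σ') = (Fin.append a a' ∘ prodPerm σ σ') ∘ Fin.cast rfl := by
  funext i
  refine Fin.addCases (fun i => ?_) (fun i => ?_) i <;> simp [prodPerm, Equiv.permCongr_apply]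

theorem append_comp_prodPerm_symm {C : Type u} {n p : ℕ} (a : Fin n → C) (a' : Fin p → C)
    (σ : Equiv.Perm (Fin n)) (σ' : Equiv.Perm (Fin p)) :
    Fin.append (a ∘ σ.symm) (a' ∘ σ'.symm) =
      (Fin.append a a' ∘ (prodPerm σ σ').symm) ∘ Fin.cast rfl :=
  append_comp_prodPerm a a' σ.symm σ'.symm

theorem append_comp_blockSwap {C : Type u} {n p : ℕ} (a : Fin n → C) (a' : Fin p → C) :
    Fin.append a a' ∘ blockSwap n p = Fin.append a' a ∘ Fin.cast (Nat.add_comm n p) := by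
  funext i
  obtain ⟨j, rfl⟩ := (finCongr (Nat.add_comm p n)).surjective i
  refine Fin.addCases (fun j => ?_) (fun j => ?_) j <;> simp [blockSwap]

theorem comp_append {C D : Type u} {n p : ℕ} (φ : C → D) (a : Fin n → C) (a' : Fin p → C) :
    Fin.append (φ ∘ a) (φ ∘ a') = (φ ∘ Fin.append a a') ∘ Fin.cast rfl := by
  funext i
  refine Fin.addCases (fun i => ?_) (fun i => ?_) i <;> simp

theorem comp_symm_comp {C : Type u} {n : ℕ} (a : Fin n → C) (σ : Equiv.Perm (Fin n)) :
    (a ∘ σ.symm) ∘ σ = a ∘ Fin.cast rfl := by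
  funext i
  simp

end PropData

/-- A (coloured) prop, in sets. -/
structure ColoredProp extends PropData.{u} where
  /-- vertical composition is associative -/
  vcomp_assoc : ∀ {n m p q : ℕ} {a : Fin n → Col} {b : Fin m → Col} {c : Fin p → Col}
    {d : Fin q → Col} (f : Op c d) (g : Op b c) (h : Op a b),
    vcomp (vcomp f g) h = vcomp f (vcomp g h)
  /-- horizontal composition is associative -/
  hcomp_assoc : ∀ {n m p q r s : ℕ} {a : Fin n → Col} {b : Fin m → Col} {a' : Fin p → Col}
    {b' : Fin q → Col} {a'' : Fin r → Col} {b'' : Fin s → Col}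
    (f : Op a b) (g : Op a' b') (h : Op a'' b''),
    toPropData.transport (Nat.add_assoc n p r) (Nat.add_assoc m q s)
      (Fin.append_assoc a a' a'') (Fin.append_assoc b b' b'') (hcomp (hcomp f g) h) =
    hcomp f (hcomp g h)
  /-- the empty horizontal composite is a left unit for horizontal composition -/
  idNil_hcomp : ∀ {n m : ℕ} {a : Fin n → Col} {b : Fin m → Col} (e : Fin 0 → Col) (f : Op a b),
    toPropData.transport (Nat.zero_add n) (Nat.zero_add m)
      (Fin.append_left_nil e a rfl) (Fin.append_left_nil e b rfl) (hcomp (idNil e) f) = f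
  /-- the empty horizontal composite is a right unit for horizontal composition -/
  hcomp_idNil : ∀ {n m : ℕ} {a : Fin n → Col} {b : Fin m → Col} (e : Fin 0 → Col) (f : Op a b),
    toPropData.transport (Nat.add_zero n) (Nat.add_zero m)
      (Fin.append_right_nil a e rfl) (Fin.append_right_nil b e rfl) (hcomp f (idNil e)) = f
  /-- `f ∘ᵥ (id_{a₁} ∘ₕ ⋯ ∘ₕ id_{aₙ}) = f` -/
  vcomp_id : ∀ {n m : ℕ} {a : Fin n → Col} {b : Fin m → Col} (f : Op a b),
    vcomp f (toPropData.idList a) = f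
  /-- `(id_{b₁} ∘ₕ ⋯ ∘ₕ id_{bₘ}) ∘ᵥ f = f` -/
  id_vcomp : ∀ {n m : ℕ} {a : Fin n → Col} {b : Fin m → Col} (f : Op a b),
    vcomp (toPropData.idList b) f = f
  /-- `(f ∘ᵥ g) ∘ₕ (f' ∘ᵥ g') = (f ∘ₕ f') ∘ᵥ (g ∘ₕ g')` -/
  interchange : ∀ {n m p n' m' p' : ℕ} {a : Fin n → Col} {b : Fin m → Col} {c : Fin p → Col}
    {a' : Fin n' → Col} {b' : Fin m' → Col} {c' : Fin p' → Col}
    (f : Op a b) (g : Op c a) (f' : Op a' b') (g' : Op c' a'),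
    hcomp (vcomp f g) (vcomp f' g') = vcomp (hcomp f f') (hcomp g g')
  /-- `f ∘ᵥ (σ_* g) = (σ^* f) ∘ᵥ g` -/
  vcomp_outAct : ∀ {n m p : ℕ} {a : Fin n → Col} {b : Fin m → Col} {c : Fin p → Col}
    (σ : Equiv.Perm (Fin n)) (f : Op (a ∘ σ.symm) b) (g : Op c a),
    vcomp f (outAct σ g) =
      vcomp (toPropData.transport rfl rfl (PropData.comp_symm_comp a σ) rfl (inAct σ f)) g
  /-- `σ^* (f ∘ᵥ g) = f ∘ᵥ (σ^* g)` -/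
  inAct_vcomp : ∀ {n m p : ℕ} {a : Fin n → Col} {b : Fin m → Col} {c : Fin p → Col}
    (σ : Equiv.Perm (Fin p)) (f : Op a b) (g : Op c a),
    inAct σ (vcomp f g) = vcomp f (inAct σ g)
  /-- `τ_* (f ∘ᵥ g) = (τ_* f) ∘ᵥ g` -/
  outAct_vcomp : ∀ {n m p : ℕ} {a : Fin n → Col} {b : Fin m → Col} {c : Fin p → Col}
    (τ : Equiv.Perm (Fin m)) (f : Op a b) (g : Op c a),
    outAct τ (vcomp f g) = vcomp (outAct τ f) g
  /-- `(σ^* f) ∘ₕ (σ'^* g) = (σ × σ')^* (f ∘ₕ g)` -/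
  inAct_hcomp : ∀ {n m p q : ℕ} {a : Fin n → Col} {b : Fin m → Col} {a' : Fin p → Col}
    {b' : Fin q → Col} (σ : Equiv.Perm (Fin n)) (σ' : Equiv.Perm (Fin p))
    (f : Op a b) (g : Op a' b'),
    toPropData.transport rfl rfl (PropData.append_comp_prodPerm a a' σ σ') rfl
      (hcomp (inAct σ f) (inAct σ' g)) =
    inAct (PropData.prodPerm σ σ') (hcomp f g)
  /-- `(τ_* f) ∘ₕ (τ'_* g) = (τ × τ')_* (f ∘ₕ g)` -/
  outAct_hcomp : ∀ {n m p q : ℕ} {a : Fin n → Col} {b : Fin m → Col} {a' : Fin p → Col}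
    {b' : Fin q → Col} (τ : Equiv.Perm (Fin m)) (τ' : Equiv.Perm (Fin q))
    (f : Op a b) (g : Op a' b'),
    toPropData.transport rfl rfl rfl (PropData.append_comp_prodPerm_symm b b' τ τ')
      (hcomp (outAct τ f) (outAct τ' g)) =
    outAct (PropData.prodPerm τ τ') (hcomp f g)
  /-- exchanging the blocks of inputs and the blocks of outputs turns `f ∘ₕ g` into `g ∘ₕ f` -/
  hcomp_swap : ∀ {n m p q : ℕ} {a : Fin n → Col} {b : Fin m → Col} {a' : Fin p → Col}
    {b' : Fin q → Col} (f : Op a b) (g : Op a' b'),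
    toPropData.transport (Nat.add_comm n p) (Nat.add_comm m q)
      (PropData.append_comp_blockSwap a a') (PropData.append_comp_blockSwap b b')
      (inAct (PropData.blockSwap n p) (outAct (PropData.blockSwap m q).symm (hcomp f g))) =
    hcomp g f
  /-- `σ^* τ_* = τ_* σ^*` -/
  inAct_outAct : ∀ {n m : ℕ} {a : Fin n → Col} {b : Fin m → Col} (σ : Equiv.Perm (Fin n))
    (τ : Equiv.Perm (Fin m)) (f : Op a b), inAct σ (outAct τ f) = outAct τ (inAct σ f)
  /-- the neutral permutation acts trivially on inputs -/
  inAct_one : ∀ {n m : ℕ} {a : Fin n → Col} {b : Fin m → Col} (f : Op a b), inAct 1 f = f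
  /-- `σ^* σ'^* = (σ' σ)^*` -/
  inAct_inAct : ∀ {n m : ℕ} {a : Fin n → Col} {b : Fin m → Col} (σ σ' : Equiv.Perm (Fin n))
    (f : Op a b), inAct σ (inAct σ' f) = inAct (σ' * σ) f
  /-- the neutral permutation acts trivially on outputs -/
  outAct_one : ∀ {n m : ℕ} {a : Fin n → Col} {b : Fin m → Col} (f : Op a b), outAct 1 f = f
  /-- `τ_* τ'_* = (τ τ')_*` -/
  outAct_outAct : ∀ {n m : ℕ} {a : Fin n → Col} {b : Fin m → Col} (τ τ' : Equiv.Perm (Fin m))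
    (f : Op a b), outAct τ (outAct τ' f) = outAct (τ * τ') f

namespace ColoredProp

/-- A homomorphism of props. -/
@[ext]
structure Hom (R T : ColoredProp.{u}) where
  onCol : R.Col → T.Col
  onOp : {n m : ℕ} → {a : Fin n → R.Col} → {b : Fin m → R.Col} →
    R.Op a b → T.Op (onCol ∘ a) (onCol ∘ b)
  map_idCol : ∀ c : R.Col, onOp (R.idCol c) = T.idCol (onCol c)
  map_idNil : ∀ e : Fin 0 → R.Col, onOp (R.idNil e) = T.idNil (onCol ∘ e)
  map_vcomp : ∀ {n m p : ℕ} {a : Fin n → R.Col} {b : Fin m → R.Col} {c : Fin p → R.Col}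
    (f : R.Op a b) (g : R.Op c a), onOp (R.vcomp f g) = T.vcomp (onOp f) (onOp g)
  map_hcomp : ∀ {n m p q : ℕ} {a : Fin n → R.Col} {b : Fin m → R.Col} {a' : Fin p → R.Col}
    {b' : Fin q → R.Col} (f : R.Op a b) (g : R.Op a' b'),
    onOp (R.hcomp f g) =
      T.transport rfl rfl (PropData.comp_append onCol a a') (PropData.comp_append onCol b b')
        (T.hcomp (onOp f) (onOp g))
  map_inAct : ∀ {n m : ℕ} {a : Fin n → R.Col} {b : Fin m → R.Col} (σ : Equiv.Perm (Fin n))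
    (f : R.Op a b), onOp (R.inAct σ f) = T.inAct σ (onOp f)
  map_outAct : ∀ {n m : ℕ} {a : Fin n → R.Col} {b : Fin m → R.Col} (τ : Equiv.Perm (Fin m))
    (f : R.Op a b), onOp (R.outAct τ f) = T.outAct τ (onOp f)

/-- The identity homomorphism. -/
def Hom.id (T : ColoredProp.{u}) : Hom T T where
  onCol := fun c => c
  onOp := fun f => f
  map_idCol := fun _ => rfl
  map_idNil := fun _ => rfl
  map_vcomp := fun _ _ => rfl
  map_hcomp := fun _ _ => rfl
  map_inAct := fun _ _ => rfl
  map_outAct := fun _ _ => rfl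

/-- A homomorphism commutes with `transport`. -/
theorem Hom.map_transport {R T : ColoredProp.{u}} (φ : Hom R T) {n n' m m' : ℕ}
    {a : Fin n → R.Col} {a' : Fin n' → R.Col} {b : Fin m → R.Col} {b' : Fin m' → R.Col}
    (hn : n = n') (hm : m = m') (ha : a = a' ∘ Fin.cast hn) (hb : b = b' ∘ Fin.cast hm)
    (f : R.Op a b) :
    φ.onOp (R.transport hn hm ha hb f) =
      T.transport hn hm (congrArg (fun x => φ.onCol ∘ x) ha) (congrArg (fun x => φ.onCol ∘ x) hb)
        (φ.onOp f) := by
  subst hn hm ha hb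
  rfl

/-- Two successive transports are one. -/
theorem transport_transport (T : PropData.{u}) {n n' n'' m m' m'' : ℕ}
    {a : Fin n → T.Col} {a' : Fin n' → T.Col} {a'' : Fin n'' → T.Col}
    {b : Fin m → T.Col} {b' : Fin m' → T.Col} {b'' : Fin m'' → T.Col}
    (hn : n = n') (hm : m = m') (ha : a = a' ∘ Fin.cast hn) (hb : b = b' ∘ Fin.cast hm)
    (hn' : n' = n'') (hm' : m' = m'') (ha' : a' = a'' ∘ Fin.cast hn')
    (hb' : b' = b'' ∘ Fin.cast hm') (f : T.Op a b) :
    T.transport hn' hm' ha' hb' (T.transport hn hm ha hb f) =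
      T.transport (hn.trans hn') (hm.trans hm') (by subst hn hn' ha ha'; rfl)
        (by subst hm hm' hb hb'; rfl) f := by
  subst hn hm ha hb hn' hm' ha' hb'
  rfl

/-- The composite `ψ ∘ φ` of homomorphisms. -/
def Hom.comp {R S T : ColoredProp.{u}} (φ : Hom R S) (ψ : Hom S T) : Hom R T where
  onCol := fun c => ψ.onCol (φ.onCol c)
  onOp := fun f => ψ.onOp (φ.onOp f)
  map_idCol := fun c => by rw [φ.map_idCol]; exact ψ.map_idCol _
  map_idNil := fun e => by rw [φ.map_idNil]; exact ψ.map_idNil _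
  map_vcomp := fun f g => by rw [φ.map_vcomp]; exact ψ.map_vcomp _ _
  map_hcomp := fun f g => by
    rw [φ.map_hcomp, Hom.map_transport, ψ.map_hcomp, transport_transport]
  map_inAct := fun σ f => by rw [φ.map_inAct]; exact ψ.map_inAct _ _
  map_outAct := fun τ f => by rw [φ.map_outAct]; exact ψ.map_outAct _ _

/-- The category of props and prop homomorphisms. -/
instance : Category.{u} ColoredProp.{u} where
  Hom := Hom
  id := Hom.id
  comp := Hom.comp
  id_comp := fun _ => rfl
  comp_id := fun _ => rfl
  assoc := fun _ _ _ => rfl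

/-- The functor sending a prop to its set of colours. -/
def colors : ColoredProp.{u} ⥤ Type u where
  obj T := T.Col
  map φ := TypeCat.ofHom φ.onCol

/-- The functor sending a prop to its set of operations with `n` inputs and `m` outputs, that is to
the disjoint union of the sets `T(a₁, …, aₙ; b₁, …, bₘ)`. -/
def operations (n m : ℕ) : ColoredProp.{u} ⥤ Type u where
  obj T := Σ (a : Fin n → T.Col) (b : Fin m → T.Col), T.Op a b
  map φ := TypeCat.ofHom fun x => ⟨φ.onCol ∘ x.1, φ.onCol ∘ x.2.1, φ.onOp x.2.2⟩

end ColoredProp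

/-!
The axioms of a prop are equations between operations. Hence raw data `D` (a `PropData`) are a prop as
soon as they carry a family of homomorphisms to props that separates the colours and the operations
of `D` (`ColoredProp.ofJointlyInjective`), and a map into `D` is a homomorphism as soon as its
composites with such a family are (`PropData.JointlyInjective.lift`). Both limits and colimits are
obtained from these two facts.

For limits, take compatible families of colours and of operations, with the projections as the
separating family. On colours and on operations this cone is the standard limit of sets. Conversely,
if a cone becomes a limit cone on colours and on operations, then its legs are jointly injective and
any other cone lifts to it on underlying sets; the lift is automatically a homomorphism
(`ColoredProp.isLimit_of_isLimit_colors_of_isLimit_operations`). So compatible families form a limit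
cone which `colors` and all `operations n m` preserve, and these functors preserve every limit.

For colimits, take as operations the formal expressions in the operations of the diagram, and
identify two colours, or two expressions, when every cocone does. The relation quantifies over the
large type of all cocones, but it is a proposition, so that the quotient stays small. Evaluation in
the cocones is jointly injective by construction, so the quotient is a prop, and evaluation in a
given cocone is the induced homomorphism; it is unique by induction on expressions. No explicit list
of generating relations is needed.

All operations are indexed by functions `Fin n → Col`, and the laws hold up to transport between
equal lists; the relation `PropData.SameOp` absorbs these transports.
-/

/-! ### Operations up to transport -/

namespace PropData

/-- `T.SameOp f f'` says that `f` and `f'` have the same lists of inputs and outputs and are the same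
operation. The two index lists are allowed to be different terms, so this relation replaces every
equation in which `PropData.transport` occurs. -/
inductive SameOp (T : PropData.{u}) {n m : ℕ} {a : Fin n → T.Col} {b : Fin m → T.Col}
    (f : T.Op a b) :
    {n' m' : ℕ} → {a' : Fin n' → T.Col} → {b' : Fin m' → T.Col} → T.Op a' b' → Prop
  | refl : SameOp T f f

namespace SameOp

variable {T : PropData.{u}} {n m n' m' n'' m'' p q p' q' : ℕ}

theorem symm {a : Fin n → T.Col} {b : Fin m → T.Col} {a' : Fin n' → T.Col} {b' : Fin m' → T.Col}
    {f : T.Op a b} {f' : T.Op a' b'} (h : T.SameOp f f') : T.SameOp f' f := by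
  cases h
  exact .refl

theorem trans {a : Fin n → T.Col} {b : Fin m → T.Col} {a' : Fin n' → T.Col} {b' : Fin m' → T.Col}
    {a'' : Fin n'' → T.Col} {b'' : Fin m'' → T.Col}
    {f : T.Op a b} {f' : T.Op a' b'} {f'' : T.Op a'' b''} (h : T.SameOp f f')
    (h' : T.SameOp f' f'') : T.SameOp f f'' := by
  cases h
  exact h'

theorem of_eq {a : Fin n → T.Col} {b : Fin m → T.Col} {f f' : T.Op a b} (h : f = f') :
    T.SameOp f f' := h ▸ .refl

theorem eq {a : Fin n → T.Col} {b : Fin m → T.Col} {f f' : T.Op a b} (h : T.SameOp f f') :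
    f = f' := by
  cases h
  rfl

theorem transport {a : Fin n → T.Col} {a' : Fin n' → T.Col} {b : Fin m → T.Col}
    {b' : Fin m' → T.Col} (hn : n = n') (hm : m = m') (ha : a = a' ∘ Fin.cast hn)
    (hb : b = b' ∘ Fin.cast hm) (f : T.Op a b) : T.SameOp (T.transport hn hm ha hb f) f := by
  subst hn hm ha hb
  exact .refl

theorem idCol {c c' : T.Col} (h : c = c') : T.SameOp (T.idCol c) (T.idCol c') := by
  subst h
  exact .refl

theorem idNil (e e' : Fin 0 → T.Col) : T.SameOp (T.idNil e) (T.idNil e') := by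
  cases Subsingleton.elim e e'
  exact .refl

theorem vcomp {a : Fin n → T.Col} {b : Fin m → T.Col} {c : Fin p → T.Col}
    {a' : Fin n' → T.Col} {b' : Fin m' → T.Col} {c' : Fin p' → T.Col}
    {f : T.Op a b} {f' : T.Op a' b'} {g : T.Op c a} {g' : T.Op c' a'}
    (hf : T.SameOp f f') (hg : T.SameOp g g') : T.SameOp (T.vcomp f g) (T.vcomp f' g') := by
  cases hf
  cases hg
  exact .refl

theorem hcomp {a : Fin n → T.Col} {b : Fin m → T.Col} {c : Fin p → T.Col} {d : Fin q → T.Col}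
    {a' : Fin n' → T.Col} {b' : Fin m' → T.Col} {c' : Fin p' → T.Col} {d' : Fin q' → T.Col}
    {f : T.Op a b} {f' : T.Op a' b'} {g : T.Op c d} {g' : T.Op c' d'}
    (hf : T.SameOp f f') (hg : T.SameOp g g') : T.SameOp (T.hcomp f g) (T.hcomp f' g') := by
  cases hf
  cases hg
  exact .refl

theorem inAct {a a' : Fin n → T.Col} {b : Fin m → T.Col} {b' : Fin m' → T.Col}
    {f : T.Op a b} {f' : T.Op a' b'} (σ : Equiv.Perm (Fin n)) (h : T.SameOp f f') :
    T.SameOp (T.inAct σ f) (T.inAct σ f') := by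
  cases h
  exact .refl

theorem outAct {a : Fin n → T.Col} {a' : Fin n' → T.Col} {b b' : Fin m → T.Col}
    {f : T.Op a b} {f' : T.Op a' b'} (τ : Equiv.Perm (Fin m)) (h : T.SameOp f f') :
    T.SameOp (T.outAct τ f) (T.outAct τ f') := by
  cases h
  exact .refl

theorem left_eq {a a' : Fin n → T.Col} {b : Fin m → T.Col}
    {b' : Fin m' → T.Col} {f : T.Op a b} {f' : T.Op a' b'} (h : T.SameOp f f') : a = a' := by
  cases h
  rfl

theorem right_eq {a : Fin n → T.Col} {a' : Fin n' → T.Col}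
    {b b' : Fin m → T.Col} {f : T.Op a b} {f' : T.Op a' b'} (h : T.SameOp f f') : b = b' := by
  cases h
  rfl

end SameOp

/-- Equality in the disjoint union that `ColoredProp.operations` uses is `SameOp`. -/
theorem sigma_eq_iff {T : PropData.{u}} {n m : ℕ}
    (x y : Σ (a : Fin n → T.Col) (b : Fin m → T.Col), T.Op a b) : x = y ↔ T.SameOp x.2.2 y.2.2 := by
  obtain ⟨a, b, f⟩ := x
  obtain ⟨a', b', f'⟩ := y
  constructor
  · intro h
    cases h
    exact .refl
  · intro h
    cases h
    rfl

/-! ### Homomorphisms of raw data -/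

/-- A homomorphism of the raw data of props, with the fields of `ColoredProp.Hom`; the transport in
its compatibility with horizontal composition is replaced by `PropData.SameOp`. -/
structure DataHom (R T : PropData.{u}) where
  /-- the map of colours -/
  onCol : R.Col → T.Col
  /-- the map of operations -/
  onOp : {n m : ℕ} → {a : Fin n → R.Col} → {b : Fin m → R.Col} →
    R.Op a b → T.Op (onCol ∘ a) (onCol ∘ b)
  map_idCol : ∀ c : R.Col, onOp (R.idCol c) = T.idCol (onCol c)
  map_idNil : ∀ e : Fin 0 → R.Col, onOp (R.idNil e) = T.idNil (onCol ∘ e)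
  map_vcomp : ∀ {n m p : ℕ} {a : Fin n → R.Col} {b : Fin m → R.Col} {c : Fin p → R.Col}
    (f : R.Op a b) (g : R.Op c a), onOp (R.vcomp f g) = T.vcomp (onOp f) (onOp g)
  map_hcomp : ∀ {n m p q : ℕ} {a : Fin n → R.Col} {b : Fin m → R.Col} {a' : Fin p → R.Col}
    {b' : Fin q → R.Col} (f : R.Op a b) (g : R.Op a' b'),
    T.SameOp (onOp (R.hcomp f g)) (T.hcomp (onOp f) (onOp g))
  map_inAct : ∀ {n m : ℕ} {a : Fin n → R.Col} {b : Fin m → R.Col} (σ : Equiv.Perm (Fin n))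
    (f : R.Op a b), onOp (R.inAct σ f) = T.inAct σ (onOp f)
  map_outAct : ∀ {n m : ℕ} {a : Fin n → R.Col} {b : Fin m → R.Col} (τ : Equiv.Perm (Fin m))
    (f : R.Op a b), onOp (R.outAct τ f) = T.outAct τ (onOp f)

namespace DataHom

variable {R T : PropData.{u}} (φ : DataHom R T) {n m n' m' : ℕ}

theorem map_sameOp {a : Fin n → R.Col} {b : Fin m → R.Col} {a' : Fin n' → R.Col}
    {b' : Fin m' → R.Col} {f : R.Op a b} {f' : R.Op a' b'} (h : R.SameOp f f') :
    T.SameOp (φ.onOp f) (φ.onOp f') := by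
  cases h
  exact .refl

theorem map_transport {a : Fin n → R.Col} {a' : Fin n' → R.Col} {b : Fin m → R.Col}
    {b' : Fin m' → R.Col} (hn : n = n') (hm : m = m') (ha : a = a' ∘ Fin.cast hn)
    (hb : b = b' ∘ Fin.cast hm) (f : R.Op a b) :
    T.SameOp (φ.onOp (R.transport hn hm ha hb f)) (φ.onOp f) :=
  φ.map_sameOp (.transport ..)

theorem map_idList : ∀ {n : ℕ} (a : Fin n → R.Col),
    T.SameOp (φ.onOp (R.idList a)) (T.idList (φ.onCol ∘ a))
  | 0, a => .of_eq (φ.map_idNil a)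
  | _ + 1, a =>
    (φ.map_transport _ _ _ _ _).trans <| (φ.map_hcomp _ _).trans <|
      (SameOp.hcomp (map_idList (Fin.init a)) (.of_eq (φ.map_idCol _))).trans
        (SameOp.transport (T := T) rfl rfl (append_init (φ.onCol ∘ a))
          (append_init (φ.onCol ∘ a)) _).symm

end DataHom

/-! ### Jointly injective families of homomorphisms -/

/-- A family of homomorphisms out of `D` is jointly injective if it separates the colours of `D` and
the operations with given lists of inputs and outputs. The members of the family may be indexed by a
large type, such as that of all cocones over a diagram. -/
structure JointlyInjective {D : PropData.{u}} {I : Type*} {T : I → PropData.{u}}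
    (p : ∀ i, DataHom D (T i)) : Prop where
  col : ∀ x y : D.Col, (∀ i, (p i).onCol x = (p i).onCol y) → x = y
  op : ∀ {n m : ℕ} {a : Fin n → D.Col} {b : Fin m → D.Col} (f g : D.Op a b),
    (∀ i, (p i).onOp f = (p i).onOp g) → f = g

namespace JointlyInjective

variable {D : PropData.{u}} {I : Type*} {T : I → PropData.{u}} {p : ∀ i, DataHom D (T i)}

/-- A jointly injective family separates operations with a priori different lists of colours. The
numbers of inputs and outputs have to agree, because the family may be empty. -/
theorem sameOp (hp : JointlyInjective p) {n m : ℕ} {a a' : Fin n → D.Col} {b b' : Fin m → D.Col}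
    {f : D.Op a b} {f' : D.Op a' b'} (h : ∀ i, (T i).SameOp ((p i).onOp f) ((p i).onOp f')) :
    D.SameOp f f' := by
  obtain rfl : a = a' := funext fun k => hp.col _ _ fun i => congrFun (h i).left_eq k
  obtain rfl : b = b' := funext fun k => hp.col _ _ fun i => congrFun (h i).right_eq k
  exact .of_eq (hp.op _ _ fun i => (h i).eq)

/-- A map into `D` whose composites with a jointly injective family are homomorphisms is itself a
homomorphism. -/
def lift (hp : JointlyInjective p) {R : PropData.{u}} (h : ∀ i, DataHom R (T i))
    (l : R.Col → D.Col) (hl : ∀ i x, (p i).onCol (l x) = (h i).onCol x)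
    (lo : ∀ {n m : ℕ} {a : Fin n → R.Col} {b : Fin m → R.Col}, R.Op a b → D.Op (l ∘ a) (l ∘ b))
    (hlo : ∀ i {n m : ℕ} {a : Fin n → R.Col} {b : Fin m → R.Col} (f : R.Op a b),
      (T i).SameOp ((p i).onOp (lo f)) ((h i).onOp f)) : DataHom R D where
  onCol := l
  onOp := lo
  map_idCol c := (hp.sameOp fun i => (hlo i _).trans <| (SameOp.of_eq ((h i).map_idCol c)).trans <|
    (SameOp.idCol (hl i c)).symm.trans (SameOp.of_eq ((p i).map_idCol _)).symm).eq
  map_idNil e := (hp.sameOp fun i => (hlo i _).trans <| (SameOp.of_eq ((h i).map_idNil e)).trans <|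
    (SameOp.idNil _ _).trans (SameOp.of_eq ((p i).map_idNil _)).symm).eq
  map_vcomp f g := (hp.sameOp fun i => (hlo i _).trans <|
    (SameOp.of_eq ((h i).map_vcomp f g)).trans <|
    (SameOp.vcomp (hlo i f) (hlo i g)).symm.trans (SameOp.of_eq ((p i).map_vcomp _ _)).symm).eq
  map_hcomp f g := hp.sameOp fun i => (hlo i _).trans <| ((h i).map_hcomp f g).trans <|
    (SameOp.hcomp (hlo i f) (hlo i g)).symm.trans ((p i).map_hcomp _ _).symm
  map_inAct σ f := (hp.sameOp fun i => (hlo i _).trans <|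
    (SameOp.of_eq ((h i).map_inAct σ f)).trans <|
    (SameOp.inAct σ (hlo i f)).symm.trans (SameOp.of_eq ((p i).map_inAct _ _)).symm).eq
  map_outAct τ f := (hp.sameOp fun i => (hlo i _).trans <|
    (SameOp.of_eq ((h i).map_outAct τ f)).trans <|
    (SameOp.outAct τ (hlo i f)).symm.trans (SameOp.of_eq ((p i).map_outAct _ _)).symm).eq

end JointlyInjective

end PropData

namespace ColoredProp

open PropData

/-- A homomorphism of raw data between props is a homomorphism of props. -/
def homOfDataHom {R T : ColoredProp.{u}} (φ : DataHom R.toPropData T.toPropData) : Hom R T where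
  onCol := φ.onCol
  onOp := φ.onOp
  map_idCol := φ.map_idCol
  map_idNil := φ.map_idNil
  map_vcomp := φ.map_vcomp
  map_hcomp f g := ((φ.map_hcomp f g).trans (SameOp.transport ..).symm).eq
  map_inAct := φ.map_inAct
  map_outAct := φ.map_outAct

/-- The homomorphism of raw data underlying a homomorphism of props. -/
def Hom.toDataHom {R T : ColoredProp.{u}} (φ : Hom R T) :
    DataHom R.toPropData T.toPropData where
  onCol := φ.onCol
  onOp := φ.onOp
  map_idCol := φ.map_idCol
  map_idNil := φ.map_idNil
  map_vcomp := φ.map_vcomp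
  map_hcomp f g := (SameOp.of_eq (φ.map_hcomp f g)).trans (SameOp.transport ..)
  map_inAct := φ.map_inAct
  map_outAct := φ.map_outAct

theorem hom_ext_sameOp {R T : ColoredProp.{u}} {φ ψ : Hom R T}
    (hc : ∀ x, φ.onCol x = ψ.onCol x)
    (ho : ∀ {n m : ℕ} {a : Fin n → R.Col} {b : Fin m → R.Col} (f : R.Op a b),
      T.SameOp (φ.onOp f) (ψ.onOp f)) : φ = ψ := by
  obtain ⟨c, o⟩ := φ
  obtain ⟨c', o'⟩ := ψ
  obtain rfl : c = c' := funext hc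
  obtain rfl : @o = @o' := by
    funext n m a b f
    exact (ho f).eq
  rfl

theorem onCol_of_comp_eq {R S T : ColoredProp.{u}} {φ : R ⟶ S} {ψ : S ⟶ T} {χ : R ⟶ T}
    (h : φ ≫ ψ = χ) (x : R.Col) : ψ.onCol (φ.onCol x) = χ.onCol x := by
  subst h
  rfl

theorem sameOp_of_comp_eq {R S T : ColoredProp.{u}} {φ : R ⟶ S} {ψ : S ⟶ T} {χ : R ⟶ T}
    (h : φ ≫ ψ = χ) {n m : ℕ} {a : Fin n → R.Col} {b : Fin m → R.Col} (f : R.Op a b) :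
    T.SameOp (ψ.onOp (φ.onOp f)) (χ.onOp f) := by
  subst h
  exact .refl

/-- Raw data with a jointly injective family of homomorphisms to props satisfy the axioms of a prop,
because all of these axioms are equations between operations. -/
def ofJointlyInjective (D : PropData.{u}) {I : Type*} {T : I → ColoredProp.{u}}
    (p : ∀ i, DataHom D (T i).toPropData) (hp : JointlyInjective p) : ColoredProp.{u} where
  toPropData := D
  vcomp_assoc f g h := hp.op _ _ fun i => by
    simp only [DataHom.map_vcomp, (T i).vcomp_assoc]
  hcomp_assoc f g h := hp.op _ _ fun i => SameOp.eq <|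
    ((p i).map_transport _ _ _ _ _).trans <| ((p i).map_hcomp _ _).trans <|
    (SameOp.hcomp ((p i).map_hcomp _ _) .refl).trans <| (SameOp.transport ..).symm.trans <|
    (SameOp.of_eq ((T i).hcomp_assoc _ _ _)).trans <|
    (SameOp.hcomp .refl ((p i).map_hcomp _ _)).symm.trans ((p i).map_hcomp _ _).symm
  idNil_hcomp e f := hp.op _ _ fun i => SameOp.eq <|
    ((p i).map_transport _ _ _ _ _).trans <| ((p i).map_hcomp _ _).trans <|
    (SameOp.hcomp (.of_eq ((p i).map_idNil _)) .refl).trans <| (SameOp.transport ..).symm.trans <|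
    SameOp.of_eq ((T i).idNil_hcomp _ _)
  hcomp_idNil e f := hp.op _ _ fun i => SameOp.eq <|
    ((p i).map_transport _ _ _ _ _).trans <| ((p i).map_hcomp _ _).trans <|
    (SameOp.hcomp .refl (.of_eq ((p i).map_idNil _))).trans <| (SameOp.transport ..).symm.trans <|
    SameOp.of_eq ((T i).hcomp_idNil _ _)
  vcomp_id f := hp.op _ _ fun i => by
    rw [DataHom.map_vcomp, ((p i).map_idList _).eq, (T i).vcomp_id]
  id_vcomp f := hp.op _ _ fun i => by
    rw [DataHom.map_vcomp, ((p i).map_idList _).eq, (T i).id_vcomp]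
  interchange f g f' g' := hp.op _ _ fun i => SameOp.eq <|
    ((p i).map_hcomp _ _).trans <|
    (SameOp.hcomp (.of_eq ((p i).map_vcomp _ _)) (.of_eq ((p i).map_vcomp _ _))).trans <|
    (SameOp.of_eq ((T i).interchange _ _ _ _)).trans <|
    (SameOp.vcomp ((p i).map_hcomp _ _) ((p i).map_hcomp _ _)).symm.trans
    (SameOp.of_eq ((p i).map_vcomp _ _)).symm
  vcomp_outAct σ f g := hp.op _ _ fun i => SameOp.eq <|
    (SameOp.of_eq ((p i).map_vcomp _ _)).trans <|
    (SameOp.vcomp .refl (.of_eq ((p i).map_outAct _ _))).trans <|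
    (SameOp.of_eq ((T i).vcomp_outAct σ _ _)).trans <|
    (SameOp.vcomp ((SameOp.transport ..).trans <| (SameOp.of_eq ((p i).map_inAct _ _)).symm.trans
      ((p i).map_transport _ _ _ _ _).symm) .refl).trans
    (SameOp.of_eq ((p i).map_vcomp _ _)).symm
  inAct_vcomp σ f g := hp.op _ _ fun i => by
    simp only [DataHom.map_vcomp, DataHom.map_inAct, (T i).inAct_vcomp]
  outAct_vcomp τ f g := hp.op _ _ fun i => by
    rw [DataHom.map_vcomp, DataHom.map_outAct, DataHom.map_vcomp, DataHom.map_outAct]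
    exact (T i).outAct_vcomp _ _ _
  inAct_hcomp σ σ' f g := hp.op _ _ fun i => SameOp.eq <|
    ((p i).map_transport _ _ _ _ _).trans <| ((p i).map_hcomp _ _).trans <|
    (SameOp.hcomp (.of_eq ((p i).map_inAct _ _)) (.of_eq ((p i).map_inAct _ _))).trans <|
    (SameOp.transport ..).symm.trans <|
    (SameOp.of_eq ((T i).inAct_hcomp σ σ' _ _)).trans <|
    (SameOp.inAct _ ((p i).map_hcomp _ _)).symm.trans
    (SameOp.of_eq ((p i).map_inAct _ _)).symm
  outAct_hcomp τ τ' f g := hp.op _ _ fun i => SameOp.eq <|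
    ((p i).map_transport _ _ _ _ _).trans <| ((p i).map_hcomp _ _).trans <|
    (SameOp.hcomp (.of_eq ((p i).map_outAct _ _)) (.of_eq ((p i).map_outAct _ _))).trans <|
    (SameOp.transport ..).symm.trans <|
    (SameOp.of_eq ((T i).outAct_hcomp τ τ' _ _)).trans <|
    (SameOp.outAct _ ((p i).map_hcomp _ _)).symm.trans
    (SameOp.of_eq ((p i).map_outAct _ _)).symm
  hcomp_swap f g := hp.op _ _ fun i => SameOp.eq <|
    ((p i).map_transport _ _ _ _ _).trans <| (SameOp.of_eq ((p i).map_inAct _ _)).trans <|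
    (SameOp.inAct _ ((SameOp.of_eq ((p i).map_outAct _ _)).trans
      (SameOp.outAct _ ((p i).map_hcomp _ _)))).trans <| (SameOp.transport ..).symm.trans <|
    (SameOp.of_eq ((T i).hcomp_swap _ _)).trans ((p i).map_hcomp _ _).symm
  inAct_outAct σ τ f := hp.op _ _ fun i => by
    rw [DataHom.map_inAct, DataHom.map_outAct, DataHom.map_outAct, DataHom.map_inAct]
    exact (T i).inAct_outAct _ _ _
  inAct_one f := hp.op _ _ fun i => ((p i).map_inAct 1 f).trans ((T i).inAct_one _)
  inAct_inAct σ σ' f := hp.op _ _ fun i => by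
    rw [DataHom.map_inAct, DataHom.map_inAct]
    exact ((T i).inAct_inAct _ _ _).trans ((p i).map_inAct (σ' * σ) f).symm
  outAct_one f := hp.op _ _ fun i => ((p i).map_outAct 1 f).trans ((T i).outAct_one _)
  outAct_outAct τ τ' f := hp.op _ _ fun i => by
    rw [DataHom.map_outAct, DataHom.map_outAct]
    exact ((T i).outAct_outAct _ _ _).trans ((p i).map_outAct (τ * τ') f).symm

open Limits

variable {J : Type u} [SmallCategory J] (F : J ⥤ ColoredProp.{u})

/-! ### Limits -/

/-- The colours of the limit: compatible families of colours. -/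
def LimCol : Type u :=
  {c : ∀ j, (F.obj j).Col // ∀ {i j : J} (φ : i ⟶ j), (F.map φ).onCol (c i) = c j}

/-- The `j`-th component of a colour of the limit. -/
def limProj (j : J) (c : LimCol F) : (F.obj j).Col := c.1 j

/-- The operations of the limit: compatible families of operations. -/
def LimOp {n m : ℕ} (a : Fin n → LimCol F) (b : Fin m → LimCol F) : Type u :=
  {f : ∀ j, (F.obj j).Op (limProj F j ∘ a) (limProj F j ∘ b) //
    ∀ {i j : J} (φ : i ⟶ j), (F.obj j).SameOp ((F.map φ).onOp (f i)) (f j)}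

/-- The raw data of the limit, with componentwise structure. -/
def limData : PropData.{u} where
  Col := LimCol F
  Op := LimOp F
  idCol c := ⟨fun j => (F.obj j).idCol (c.1 j), fun φ =>
    (SameOp.of_eq ((F.map φ).map_idCol _)).trans (SameOp.idCol (c.2 φ))⟩
  idNil e := ⟨fun j => (F.obj j).idNil (limProj F j ∘ e), fun φ =>
    (SameOp.of_eq ((F.map φ).map_idNil _)).trans (SameOp.idNil _ _)⟩
  vcomp f g := ⟨fun j => (F.obj j).vcomp (f.1 j) (g.1 j), fun φ =>
    (SameOp.of_eq ((F.map φ).map_vcomp _ _)).trans (SameOp.vcomp (f.2 φ) (g.2 φ))⟩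
  hcomp {_ _ _ _ a b a' b'} f g := ⟨fun j => (F.obj j).transport rfl rfl
      (comp_append (limProj F j) a a') (comp_append (limProj F j) b b')
      ((F.obj j).hcomp (f.1 j) (g.1 j)), fun φ =>
    ((F.map φ).toDataHom.map_transport _ _ _ _ _).trans <|
      ((F.map φ).toDataHom.map_hcomp _ _).trans <|
      (SameOp.hcomp (f.2 φ) (g.2 φ)).trans (SameOp.transport ..).symm⟩
  inAct σ f := ⟨fun j => (F.obj j).inAct σ (f.1 j), fun φ =>
    (SameOp.of_eq ((F.map φ).map_inAct _ _)).trans (SameOp.inAct σ (f.2 φ))⟩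
  outAct τ f := ⟨fun j => (F.obj j).outAct τ (f.1 j), fun φ =>
    (SameOp.of_eq ((F.map φ).map_outAct _ _)).trans (SameOp.outAct τ (f.2 φ))⟩

/-- The `j`-th projection of the limit. -/
def limProjHom (j : J) : DataHom (limData F) (F.obj j).toPropData where
  onCol := limProj F j
  onOp f := f.1 j
  map_idCol _ := rfl
  map_idNil _ := rfl
  map_vcomp _ _ := rfl
  map_hcomp {_ _ _ _ a b a' b'} _ _ := SameOp.transport rfl rfl
    (comp_append (limProj F j) a a') (comp_append (limProj F j) b b') _
  map_inAct _ _ := rfl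
  map_outAct _ _ := rfl

theorem limProjHom_jointlyInjective : JointlyInjective (limProjHom F) where
  col _ _ h := Subtype.ext (funext h)
  op _ _ h := Subtype.ext (funext h)

/-- The cone of compatible families. -/
def limCone : Cone F where
  pt := ofJointlyInjective (limData F) (limProjHom F) (limProjHom_jointlyInjective F)
  π :=
    { app j := homOfDataHom (limProjHom F j)
      naturality _ _ φ := by
        refine (hom_ext_sameOp (fun c => ?_) fun f => ?_).symm
        · exact Subtype.property c φ
        · exact Subtype.property f φ }

variable {F}

/-- The legs of a cone, as homomorphisms of raw data. -/
def coneHom (c : Cone F) (j : J) : DataHom c.pt.toPropData (F.obj j).toPropData :=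
  (c.π.app j).toDataHom

theorem map_coneHom_col (c : Cone F) {i j : J} (φ : i ⟶ j) (x : c.pt.Col) :
    (F.map φ).onCol ((coneHom c i).onCol x) = (coneHom c j).onCol x :=
  onCol_of_comp_eq (c.w φ) x

theorem map_coneHom_op (c : Cone F) {i j : J} (φ : i ⟶ j) {n m : ℕ} {a : Fin n → c.pt.Col}
    {b : Fin m → c.pt.Col} (f : c.pt.Op a b) :
    (F.obj j).SameOp ((F.map φ).onOp ((coneHom c i).onOp f)) ((coneHom c j).onOp f) :=
  sameOp_of_comp_eq (c.w φ) f

theorem isLimit_colors_iff (c : Cone F) :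
    Nonempty (IsLimit (colors.mapCone c)) ↔
      ∀ s : LimCol F, ∃! x : c.pt.Col, ∀ j, (coneHom c j).onCol x = limProj F j s :=
  (Types.isLimit_iff _).trans
    ⟨fun h s => h s.1 fun φ => s.2 φ, fun h s hs => h ⟨s, fun φ => hs φ⟩⟩

/-- The image of a cone under `operations n m` is a limit cone if and only if every compatible family
of operations comes from a unique operation of the vertex. -/
theorem isLimit_operations_iff (c : Cone F) (n m : ℕ) :
    Nonempty (IsLimit ((operations n m).mapCone c)) ↔
      ∀ s : ∀ j, Σ (a : Fin n → (F.obj j).Col) (b : Fin m → (F.obj j).Col), (F.obj j).Op a b,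
        (∀ {i j : J} (φ : i ⟶ j), (F.obj j).SameOp ((F.map φ).onOp (s i).2.2) (s j).2.2) →
        ∃! x : Σ (a : Fin n → c.pt.Col) (b : Fin m → c.pt.Col), c.pt.Op a b,
          ∀ j, (F.obj j).SameOp ((coneHom c j).onOp x.2.2) (s j).2.2 := by
  have key (s : ∀ j, Σ (a : Fin n → (F.obj j).Col) (b : Fin m → (F.obj j).Col), (F.obj j).Op a b)
      (x : Σ (a : Fin n → c.pt.Col) (b : Fin m → c.pt.Col), c.pt.Op a b) :
      (∀ j, (((operations n m).mapCone c).π.app j) x = s j) ↔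
        ∀ j, (F.obj j).SameOp ((coneHom c j).onOp x.2.2) (s j).2.2 :=
    forall_congr' fun j => sigma_eq_iff _ _
  refine (Types.isLimit_iff _).trans ⟨fun h s hs => ?_, fun h s hs => ?_⟩
  · exact (existsUnique_congr (key s)).1 (h s fun φ => (sigma_eq_iff _ _).2 (hs φ))
  · exact (existsUnique_congr (key s)).2 (h s fun φ => (sigma_eq_iff _ _).1 (hs φ))

theorem isLimit_colors_limCone : Nonempty (IsLimit (colors.mapCone (limCone F))) :=
  (isLimit_colors_iff _).2 fun s =>
    ⟨s, fun _ => rfl, fun _ h => (limProjHom_jointlyInjective F).col _ _ h⟩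

theorem isLimit_operations_limCone (n m : ℕ) :
    Nonempty (IsLimit ((operations n m).mapCone (limCone F))) := by
  refine (isLimit_operations_iff _ n m).2 fun s hs => ?_
  -- the input and output colours of a compatible family of operations are compatible families
  let a : Fin n → LimCol F := fun k => ⟨fun j => (s j).1 k, fun φ => congrFun (hs φ).left_eq k⟩
  let b : Fin m → LimCol F := fun k => ⟨fun j => (s j).2.1 k, fun φ => congrFun (hs φ).right_eq k⟩
  let f : LimOp F a b := ⟨fun j => (s j).2.2, fun φ => hs φ⟩
  refine ⟨⟨a, b, f⟩, fun _ => .refl, fun y hy => (sigma_eq_iff (T := limData F) _ _).2 ?_⟩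
  exact (limProjHom_jointlyInjective F).sameOp fun j => hy j

theorem coneHom_jointlyInjective {c : Cone F} (hc : Nonempty (IsLimit (colors.mapCone c)))
    (ho : ∀ n m : ℕ, Nonempty (IsLimit ((operations n m).mapCone c))) :
    JointlyInjective (coneHom c) where
  col _ y h := ((isLimit_colors_iff c).1 hc ⟨_, fun φ => map_coneHom_col c φ y⟩).unique h
    fun _ => rfl
  op f g h := SameOp.eq <| (sigma_eq_iff ⟨_, _, f⟩ ⟨_, _, g⟩).1 <|
    ((isLimit_operations_iff c _ _).1 (ho _ _) (fun j => ⟨_, _, (coneHom c j).onOp g⟩)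
      fun φ => map_coneHom_op c φ g).unique (fun j => .of_eq (h j)) fun _ => .refl

theorem exists_col_lift {c : Cone F} (hc : Nonempty (IsLimit (colors.mapCone c)))
    (s : Cone F)
    (x : s.pt.Col) : ∃ y : c.pt.Col, ∀ j, (coneHom c j).onCol y = (coneHom s j).onCol x :=
  ((isLimit_colors_iff c).1 hc ⟨_, fun φ => map_coneHom_col s φ x⟩).exists

theorem exists_op_lift {c : Cone F} (hc : Nonempty (IsLimit (colors.mapCone c)))
    (ho : ∀ n m : ℕ, Nonempty (IsLimit ((operations n m).mapCone c)))
    (s : Cone F) (l : s.pt.Col → c.pt.Col)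
    (hl : ∀ x j, (coneHom c j).onCol (l x) = (coneHom s j).onCol x) {n m : ℕ}
    {a : Fin n → s.pt.Col} {b : Fin m → s.pt.Col} (f : s.pt.Op a b) :
    ∃ g : c.pt.Op (l ∘ a) (l ∘ b),
      ∀ j, (F.obj j).SameOp ((coneHom c j).onOp g) ((coneHom s j).onOp f) := by
  obtain ⟨⟨a', b', g⟩, hg⟩ := ((isLimit_operations_iff c n m).1 (ho n m)
    (fun j => ⟨_, _, (coneHom s j).onOp f⟩) fun φ => map_coneHom_op s φ f).exists
  have hp := coneHom_jointlyInjective hc ho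
  have ha : a' = l ∘ a := funext fun k => hp.col _ _ fun j =>
    (congrFun (hg j).left_eq k).trans (hl (a k) j).symm
  have hb : b' = l ∘ b := funext fun k => hp.col _ _ fun j =>
    (congrFun (hg j).right_eq k).trans (hl (b k) j).symm
  subst ha hb
  exact ⟨g, hg⟩

/-- A cone is a limit cone if it becomes one on colours and on operations: a second cone is lifted on
underlying sets, and the lift is a homomorphism since the legs are jointly injective. -/
theorem isLimit_of_isLimit_colors_of_isLimit_operations {c : Cone F}
    (hc : Nonempty (IsLimit (colors.mapCone c)))
    (ho : ∀ n m : ℕ, Nonempty (IsLimit ((operations n m).mapCone c))) :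
    Nonempty (IsLimit c) := by
  have hp := coneHom_jointlyInjective hc ho
  choose l hl using fun s => exists_col_lift hc s
  choose lo hlo using fun s => @exists_op_lift _ _ _ _ hc ho s (l s) (hl s)
  refine ⟨{
    lift s := homOfDataHom (hp.lift (coneHom s) (l s) (fun i x => hl s x i) (fun f => lo s f)
      (fun i _ _ _ _ f => hlo s f i))
    fac s j := hom_ext_sameOp (fun x => hl s x j) fun f => hlo s f j
    uniq s ψ hψ := ?_ }⟩
  exact hom_ext_sameOp
    (fun x => hp.col _ _ fun j => (onCol_of_comp_eq (hψ j) x).trans (hl s x j).symm)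
    fun f => hp.sameOp fun j => (sameOp_of_comp_eq (hψ j) f).trans (hlo s f j).symm

theorem nonempty_isLimit_limCone : Nonempty (IsLimit (limCone F)) :=
  isLimit_of_isLimit_colors_of_isLimit_operations isLimit_colors_limCone
    isLimit_operations_limCone

theorem nonempty_isLimit_iff (c : Cone F) :
    Nonempty (IsLimit c) ↔ Nonempty (IsLimit (colors.mapCone c)) ∧
      ∀ n m : ℕ, Nonempty (IsLimit ((operations n m).mapCone c)) := by
  refine ⟨fun ⟨hc⟩ => ?_, fun h => isLimit_of_isLimit_colors_of_isLimit_operations h.1 h.2⟩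
  obtain ⟨hL⟩ := nonempty_isLimit_limCone (F := F)
  have := preservesLimit_of_preserves_limit_cone hL (isLimit_colors_limCone (F := F)).some
  have (n m : ℕ) :=
    preservesLimit_of_preserves_limit_cone hL (isLimit_operations_limCone (F := F) n m).some
  exact ⟨⟨isLimitOfPreserves colors hc⟩, fun n m => ⟨isLimitOfPreserves (operations n m) hc⟩⟩

variable (F)

/-! ### Colimits -/

/-- Two colours in the diagram are identified when every cocone identifies them. This quantifies over
a large type, but it is a proposition, so that the quotient is small. -/
def colimColSetoid : Setoid (Σ j, (F.obj j).Col) where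
  r x y := ∀ s : Cocone F, (s.ι.app x.1).onCol x.2 = (s.ι.app y.1).onCol y.2
  iseqv := ⟨fun _ _ => rfl, fun h s => (h s).symm, fun h h' s => (h s).trans (h' s)⟩

/-- The colours of the colimit. -/
def ColimCol : Type u := Quotient (colimColSetoid F)

/-- The map of colours into the colimit. -/
def colimIncl (j : J) (c : (F.obj j).Col) : ColimCol F := Quotient.mk (colimColSetoid F) ⟨j, c⟩

variable {F} in
/-- The map on the colours of the colimit that is induced by a cocone. -/
def evalCol (s : Cocone F) : ColimCol F → s.pt.Col :=
  Quotient.lift (fun x => (s.ι.app x.1).onCol x.2) fun _ _ h => h s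

/-- Formal expressions in the operations of the props of the diagram. -/
inductive Term : {n m : ℕ} → (Fin n → ColimCol F) → (Fin m → ColimCol F) → Type u
  | of {n m : ℕ} (j : J) {a : Fin n → (F.obj j).Col} {b : Fin m → (F.obj j).Col}
      (f : (F.obj j).Op a b) : Term (colimIncl F j ∘ a) (colimIncl F j ∘ b)
  | idCol (c : ColimCol F) : Term (fun _ : Fin 1 => c) (fun _ : Fin 1 => c)
  | idNil (e : Fin 0 → ColimCol F) : Term e e
  | vcomp {n m p : ℕ} {c : Fin p → ColimCol F} {a : Fin n → ColimCol F} {b : Fin m → ColimCol F}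
      (f : Term a b) (g : Term c a) : Term c b
  | hcomp {n m p q : ℕ} {a : Fin n → ColimCol F} {b : Fin m → ColimCol F}
      {a' : Fin p → ColimCol F} {b' : Fin q → ColimCol F}
      (f : Term a b) (g : Term a' b') : Term (Fin.append a a') (Fin.append b b')
  | inAct {n m : ℕ} {a : Fin n → ColimCol F} {b : Fin m → ColimCol F} (σ : Equiv.Perm (Fin n))
      (f : Term a b) : Term (a ∘ σ) b
  | outAct {n m : ℕ} {a : Fin n → ColimCol F} {b : Fin m → ColimCol F} (τ : Equiv.Perm (Fin m))
      (f : Term a b) : Term a (b ∘ τ.symm)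

variable {F} in
/-- The value of a formal expression in the vertex of a cocone. -/
def Term.eval (s : Cocone F) : {n m : ℕ} → {a : Fin n → ColimCol F} → {b : Fin m → ColimCol F} →
    Term F a b → s.pt.Op (evalCol s ∘ a) (evalCol s ∘ b)
  | _, _, _, _, .of j f => (s.ι.app j).onOp f
  | _, _, _, _, .idCol c => s.pt.idCol (evalCol s c)
  | _, _, _, _, .idNil e => s.pt.idNil (evalCol s ∘ e)
  | _, _, _, _, .vcomp f g => s.pt.vcomp (f.eval s) (g.eval s)
  | _, _, _, _, .hcomp (a := a) (b := b) (a' := a') (b' := b') f g =>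
      s.pt.transport rfl rfl (comp_append (evalCol s) a a') (comp_append (evalCol s) b b')
        (s.pt.hcomp (f.eval s) (g.eval s))
  | _, _, _, _, .inAct σ f => s.pt.inAct σ (f.eval s)
  | _, _, _, _, .outAct τ f => s.pt.outAct τ (f.eval s)

/-- Two formal expressions are identified when they have the same value in every cocone. -/
def termSetoid {n m : ℕ} (a : Fin n → ColimCol F) (b : Fin m → ColimCol F) :
    Setoid (Term F a b) where
  r f g := ∀ s : Cocone F, f.eval s = g.eval s
  iseqv := ⟨fun _ _ => rfl, fun h s => (h s).symm, fun h h' s => (h s).trans (h' s)⟩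

/-- The raw data of the colimit: formal expressions modulo equality in all cocones. -/
def colimData : PropData.{u} where
  Col := ColimCol F
  Op a b := Quotient (termSetoid F a b)
  idCol c := Quotient.mk _ (.idCol c)
  idNil e := Quotient.mk _ (.idNil e)
  vcomp := Quotient.map₂ .vcomp fun _ _ h _ _ h' s => by simp only [Term.eval, h s, h' s]
  hcomp := Quotient.map₂ .hcomp fun _ _ h _ _ h' s => by simp only [Term.eval, h s, h' s]
  inAct σ := Quotient.map (.inAct σ) fun _ _ h s => by simp only [Term.eval, h s]
  outAct τ := Quotient.map (.outAct τ) fun _ _ h s => by simp only [Term.eval, h s]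

variable {F} in
/-- The homomorphism from the colimit that is induced by a cocone. -/
def evalHom (s : Cocone F) : DataHom (colimData F) s.pt.toPropData where
  onCol := evalCol s
  onOp := Quotient.lift (Term.eval s) fun _ _ h => h s
  map_idCol _ := rfl
  map_idNil _ := rfl
  map_vcomp f g := Quotient.inductionOn₂ f g fun _ _ => rfl
  map_hcomp f g := Quotient.inductionOn₂ f g fun _ _ => SameOp.transport ..
  map_inAct _ f := Quotient.inductionOn f fun _ => rfl
  map_outAct _ f := Quotient.inductionOn f fun _ => rfl

theorem evalHom_jointlyInjective : JointlyInjective (evalHom (F := F)) where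
  col x y := Quotient.inductionOn₂ x y fun _ _ h => Quotient.sound h
  op f g := Quotient.inductionOn₂ f g fun _ _ h => Quotient.sound h

/-- The inclusion of a prop of the diagram into the colimit. -/
def colimInclHom (j : J) : DataHom (F.obj j).toPropData (colimData F) :=
  (evalHom_jointlyInjective F).lift (fun s => (s.ι.app j).toDataHom) (colimIncl F j)
    (fun _ _ => rfl) (fun f => Quotient.mk _ (.of j f)) fun _ _ _ _ _ _ => .refl

/-- The cocone of formal expressions modulo equality in all cocones. It is natural because every
cocone is. -/
def colimCocone : Cocone F where
  pt := ofJointlyInjective (colimData F) evalHom (evalHom_jointlyInjective F)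
  ι :=
    { app j := homOfDataHom (colimInclHom F j)
      naturality i j φ := by
        refine hom_ext_sameOp
          (fun x => (evalHom_jointlyInjective F).col _ _ fun s =>
            onCol_of_comp_eq (s.w φ) x)
          fun f => (evalHom_jointlyInjective F).sameOp fun s => ?_
        exact sameOp_of_comp_eq (s.w φ) f }

variable {F} in
/-- A homomorphism from the colimit is determined by its restrictions along the inclusions, by
induction on formal expressions. -/
theorem sameOp_eval_of_fac (s : Cocone F) (ψ : DataHom (colimData F) s.pt.toPropData)
    (hc : ∀ x, ψ.onCol x = evalCol s x)
    (ho : ∀ (j : J) {n m : ℕ} {a : Fin n → (F.obj j).Col} {b : Fin m → (F.obj j).Col}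
      (f : (F.obj j).Op a b),
      s.pt.SameOp (ψ.onOp ((colimInclHom F j).onOp f)) ((s.ι.app j).onOp f))
    {n m : ℕ} {a : Fin n → ColimCol F} {b : Fin m → ColimCol F} (t : Term F a b) :
    s.pt.SameOp (ψ.onOp (Quotient.mk (termSetoid F a b) t)) (t.eval s) := by
  induction t with
  | of j f => exact ho j f
  | idCol c => exact (SameOp.of_eq (ψ.map_idCol c)).trans (.idCol (hc c))
  | idNil e => exact (SameOp.of_eq (ψ.map_idNil e)).trans (.idNil _ _)
  | vcomp f g hf hg => exact (SameOp.of_eq (ψ.map_vcomp _ _)).trans (.vcomp hf hg)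
  | hcomp f g hf hg =>
    exact (ψ.map_hcomp _ _).trans <| (SameOp.hcomp hf hg).trans (SameOp.transport ..).symm
  | inAct σ f hf => exact (SameOp.of_eq (ψ.map_inAct σ _)).trans (.inAct σ hf)
  | outAct τ f hf => exact (SameOp.of_eq (ψ.map_outAct τ _)).trans (.outAct τ hf)

/-- The cocone of formal expressions is a colimit cocone. -/
def isColimitColimCocone : IsColimit (colimCocone F) where
  desc s := homOfDataHom (evalHom s)
  fac _ _ := rfl
  uniq s ψ hψ := by
    have hc : ∀ x, ψ.onCol x = evalCol s x := fun x => Quotient.inductionOn x fun x =>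
      onCol_of_comp_eq (hψ x.1) x.2
    refine hom_ext_sameOp hc fun f => Quotient.inductionOn f fun t =>
      sameOp_eval_of_fac s ψ.toDataHom hc (fun j _ _ _ _ f => ?_) t
    exact sameOp_of_comp_eq (hψ j) f

end ColoredProp

theorem theoremT :
    Limits.HasColimits ColoredProp.{u} ∧
    Limits.HasLimits ColoredProp.{u} ∧
    ∀ (J : Type u) [SmallCategory J] (F : J ⥤ ColoredProp.{u}) (c : Limits.Cone F),
      Nonempty (Limits.IsLimit c) ↔
        Nonempty (Limits.IsLimit (ColoredProp.colors.mapCone c)) ∧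
        ∀ n m : ℕ, Nonempty (Limits.IsLimit ((ColoredProp.operations n m).mapCone c)) := by
  refine ⟨⟨fun J _ => ⟨fun F => ⟨⟨⟨_, ColoredProp.isColimitColimCocone F⟩⟩⟩⟩⟩,
    ⟨fun J _ => ⟨fun F => ⟨⟨⟨_, ColoredProp.nonempty_isLimit_limCone.some⟩⟩⟩⟩⟩,
    fun J _ F c => ColoredProp.nonempty_isLimit_iff c⟩
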